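/- Let $\kappa$ be a regular uncountable cardinal. For $w\subseteq\kappa$ let $L'_w=\langle O,P_\alpha,p_\alpha:\alpha\in w\rangle$, where $O$ and the $P_\alpha$ are unary predicates and the $p_\alpha$ are unary function symbols, and let $T'_w$ be the universal $L'_w$-theory saying that $O$ and the $P_\alpha$ ($\alpha\in w$) are pairwise disjoint and that, for each $\alpha\in w$, $p_\alpha(x)\in P_\alpha$ for all $x\in O$ and $p_\alpha(x)=x$ for all $x\notin O$. For finite $w\subset\kappa$ let $T^\dagger_w$ be the complete theory of the Fraïssé limit of the class of all finite models of $T'_w$ (the empty structure being allowed), that is, of the unique countable ultrahomogeneous $L'_w$-structure whose age is that class. Let $T^\dagger_\kappa=\bigcup_{w\subset\kappa\text{ finite}}T^\dagger_w$. For a complete theory $T$, an inp-pattern of height $\lambda$ in $n$ free variables modulo $T$ consists of formulas $\varphi_i(x;y_i)$ ($i<\lambda$) with $x$ an $n$-tuple and each $y_i$ a finite tuple, parameter tuples $a_{i,j}$ ($i<\lambda$, $j<\omega$) from a model of $T$, and numbers $k_i<\omega$, such that for every $\eta:\lambda\to\omega$ the set $\{\varphi_i(x;a_{i,\eta(i)}):i<\lambda\}$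 is consistent (finitely satisfiable in the model), and for every $i<\lambda$ the family $(\varphi_i(x;a_{i,j}):j<\omega)$ is $k_i$-inconsistent (any $k_i$ of its members, with distinct indices $j$, are jointly inconsistent). Let $\kappa^n_{\mathrm{inp}}(T)$ be the least cardinal $\lambda$ such that there is no inp-pattern of height $\lambda$ in $n$ free variables modulo $T$ (and $\infty$ if there is no such $\lambda$), and let $\kappa_{\mathrm{inp}}(T)=\sup_{n<\omega}\kappa^n_{\mathrm{inp}}(T)$. Then $\kappa_{\mathrm{inp}}(T^\dagger_\kappa)=\kappa^+$. -/

import Mathlib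

open FirstOrder FirstOrder.Language Cardinal

universe u

/-! ### inp-patterns and the invariant `κ_inp` -/

/-- An *inp-pattern* in `n` free variables, with set of rows `ι`, in the structure `M`: formulas
`φ i (x; y_i)` with `x` an `n`-tuple and `y_i` a finite tuple of length `arity i`, parameters
`a i j` from `M` for `j < ω`, and numbers `k i < ω` such that every path
`{φ i (x; a i (η i)) : i}` is consistent, and every row `{φ i (x; a i j) : j < ω}` is
`k i`-inconsistent.

A set of formulas with parameters in `M` is consistent (with the elementary diagram of `M`) when
each finite part of it has a solution in `M`. A row is a family indexed by `j < ω`; it is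
`k`-inconsistent when no `k` members with distinct indices have a common solution. -/
structure InpPattern {L : FirstOrder.Language.{u, u}} (M : Type u) [L.Structure M] (n : ℕ) (ι : Type u) where
  arity : ι → ℕ
  φ : ∀ i, L.Formula (Fin n ⊕ Fin (arity i))
  a : ∀ i, ℕ → Fin (arity i) → M
  k : ι → ℕ
  path_consistent : ∀ (η : ι → ℕ) (s : Finset ι),
    ∃ b : Fin n → M, ∀ i ∈ s, (φ i).Realize (Sum.elim b (a i (η i)))
  row_inconsistent : ∀ (i : ι) (s : Finset ℕ), s.card = k i →
    ¬ ∃ b : Fin n → M, ∀ j ∈ s, (φ i).Realize (Sum.elim b (a i j))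

/-- There is an inp-pattern of height `c` in `n` free variables modulo `T`. -/
def HasInpPattern {L : FirstOrder.Language.{u, u}} (T : L.Theory) (n : ℕ) (c : Cardinal.{u}) : Prop :=
  ∃ M : T.ModelType.{u, u, u}, Nonempty (InpPattern (L := L) M n c.ord.ToType)

/-- `κ_inp^n(T)`: the first cardinal `c` such that there is no inp-pattern of height `c` in `n`
free variables; it is `⊤` (that is, `∞`) when there is no such cardinal. -/
noncomputable def kappaInpVar {L : FirstOrder.Language.{u, u}} (T : L.Theory) (n : ℕ) :
    WithTop Cardinal.{u} :=
  sInf ((fun c : Cardinal.{u} => (c : WithTop Cardinal.{u})) '' {c | ¬ HasInpPattern T n c})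

/-- `κ_inp(T) = sup_n κ_inp^n(T)`. -/
noncomputable def kappaInp {L : FirstOrder.Language.{u, u}} (T : L.Theory) : WithTop Cardinal.{u} :=
  ⨆ n : ℕ, kappaInpVar T n

/-! ### The theory `T^†` -/

/-- Relation symbols: unary predicates `O` and `P α` (`α ∈ I`). -/
inductive DaggerRel (I : Type u) : ℕ → Type u
  | O : DaggerRel I 1
  | P (α : I) : DaggerRel I 1

/-- Function symbols: unary functions `p α` (`α ∈ I`). -/
inductive DaggerFun (I : Type u) : ℕ → Type u
  | p (α : I) : DaggerFun I 1

/-- The language `⟨O, P_α, p_α : α ∈ I⟩`. -/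
def daggerLang (I : Type u) : FirstOrder.Language.{u, u} := ⟨DaggerFun I, DaggerRel I⟩

instance (I : Type u) [Countable I] : Countable (Σ l, (daggerLang I).Functions l) := by
  refine Function.Surjective.countable
    (f := fun α : I => (⟨1, DaggerFun.p α⟩ : Σ l, (daggerLang I).Functions l)) ?_
  rintro ⟨_, ⟨α⟩⟩
  exact ⟨α, rfl⟩

namespace daggerLang

variable {I : Type u}

/-- The atomic formula `O(t)`. -/
def isO {n : ℕ} (t : (daggerLang I).Term (Empty ⊕ Fin n)) :
    (daggerLang I).BoundedFormula Empty n :=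
  Relations.boundedFormula₁ (L := daggerLang I) DaggerRel.O t

/-- The atomic formula `P_α(t)`. -/
def isP {n : ℕ} (α : I) (t : (daggerLang I).Term (Empty ⊕ Fin n)) :
    (daggerLang I).BoundedFormula Empty n :=
  Relations.boundedFormula₁ (L := daggerLang I) (DaggerRel.P α) t

/-- The term `p_α(t)`. -/
def app {n : ℕ} (α : I) (t : (daggerLang I).Term (Empty ⊕ Fin n)) :
    (daggerLang I).Term (Empty ⊕ Fin n) :=
  Functions.apply₁ (L := daggerLang I) (DaggerFun.p α) t

/-- The inclusion of `⟨O, P_α, p_α : α ∈ w⟩` in `⟨O, P_α, p_α : α ∈ I⟩`. -/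
def incl (w : Finset I) : daggerLang w →ᴸ daggerLang I where
  onFunction := fun _ f => match f with
    | DaggerFun.p α => DaggerFun.p (α : I)
  onRelation := fun _ r => match r with
    | DaggerRel.O => DaggerRel.O
    | DaggerRel.P α => DaggerRel.P (α : I)

end daggerLang

open daggerLang in
/-- The universal theory `T'`: the predicates `O`, `P_α` are pairwise disjoint, `p_α` maps `O` into
`P_α`, and `p_α` is the identity off `O`. -/
def daggerBase (I : Type u) : (daggerLang I).Theory :=
  {ψ | ∃ α : I, ψ = ∀' ∼(isO (&0) ⊓ isP α (&0))} ∪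
  {ψ | ∃ α β : I, α ≠ β ∧ ψ = ∀' ∼(isP α (&0) ⊓ isP β (&0))} ∪
  {ψ | ∃ α : I, ψ = ∀' (isO (&0) ⟹ isP α (app α (&0)))} ∪
  {ψ | ∃ α : I, ψ = ∀' (∼(isO (&0)) ⟹ (app α (&0) =' &0))}

/-- The class `𝕂'` of finite models of `T'` (the empty structure is allowed). -/
def daggerClass (I : Type u) : Set (CategoryTheory.Bundled.{0} (daggerLang I).Structure) :=
  {A | Finite A ∧ A ⊨ daggerBase I}

/-- For countable `I` (below: finite `I`), the theory of the Fraïssé limit of the class of finite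
models of `T'`, i.e. of the countable ultrahomogeneous structure with that age, which is unique
up to isomorphism. -/
def daggerFraisse (I : Type u) [Countable I] : (daggerLang I).Theory :=
  {ψ | ∃ (M : Type) (_ : (daggerLang I).Structure M) (_ : Countable M),
    IsFraisseLimit (daggerClass I) M ∧ ψ ∈ (daggerLang I).completeTheory M}

/-- The theory `T^†` with index set `I`: the union over the finite `w ⊆ I` of the theories of the
Fraïssé limits for the finite sublanguages `⟨O, P_α, p_α : α ∈ w⟩`. -/
def daggerTheory (I : Type u) : (daggerLang I).Theory :=
  ⋃ w : Finset I, (daggerLang.incl w).onTheory (daggerFraisse w)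

universe v w

namespace daggerLang

/-! ### Rich structures, similarities and back-and-forth. -/

section Semantics

variable (I : Type u) {M : Type v} [(daggerLang I).Structure M]
  {N : Type w} [(daggerLang I).Structure N]

/-- Interpretation of the predicate `O`. -/
def InO (x : M) : Prop := Structure.RelMap (L := daggerLang I) (n := 1) DaggerRel.O ![x]

variable {I}

/-- Interpretation of the predicate `P α`. -/
def InP (α : I) (x : M) : Prop :=
  Structure.RelMap (L := daggerLang I) (n := 1) (DaggerRel.P α) ![x]

/-- Interpretation of the function `p α`. -/
def proj (α : I) (x : M) : M :=
  Structure.funMap (L := daggerLang I) (n := 1) (DaggerFun.p α) ![x]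

theorem relMap_O (x : Fin 1 → M) :
    Structure.RelMap (L := daggerLang I) (n := 1) DaggerRel.O x ↔ InO I (x 0) :=
  iff_of_eq (congrArg _ (funext fun j => by rw [Subsingleton.elim j 0]; rfl))

theorem relMap_P (α : I) (x : Fin 1 → M) :
    Structure.RelMap (L := daggerLang I) (n := 1) (DaggerRel.P α) x ↔ InP α (x 0) :=
  iff_of_eq (congrArg _ (funext fun j => by rw [Subsingleton.elim j 0]; rfl))

theorem funMap_p (α : I) (x : Fin 1 → M) :
    Structure.funMap (L := daggerLang I) (n := 1) (DaggerFun.p α) x = proj α (x 0) :=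
  congrArg _ (funext fun j => by rw [Subsingleton.elim j 0]; rfl)

/-- The function `p α`, or the identity for the index `none`. -/
def projOpt : Option I → M → M
  | none, x => x
  | some α, x => proj α x

/-- The index of a composition of two functions `projOpt c` and `projOpt d`. -/
def compIdx : Option I → Option I → Option I
  | c, none => c
  | _, some β => some β

variable (I M)

/-- The structure is a model of the universal theory `T'`, in semantic form. -/
structure IsBase : Prop where
  not_inP : ∀ (α : I) (x : M), InO I x → ¬ InP α x
  eq_of_inP : ∀ (α β : I) (x : M), InP α x → InP β x → α = β
  inP_proj : ∀ (α : I) (x : M), InO I x → InP α (proj α x)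
  proj_eq : ∀ (α : I) (x : M), ¬ InO I x → proj α x = x

/-- A model of `T'` in which each sort is infinite and in which each choice of projections is
attained infinitely often. -/
structure IsRich : Prop extends IsBase I M where
  exists_inP : ∀ (α : I) (F : Set M), F.Finite → ∃ y ∉ F, InP α y
  exists_rest : ∀ F : Set M, F.Finite → ∃ y ∉ F, ¬ InO I y ∧ ∀ α : I, ¬ InP α y
  exists_inO : ∀ c : I → M, (∀ α, InP α (c α)) → ∀ F : Set M, F.Finite →
    ∃ y ∉ F, InO I y ∧ ∀ α, proj α y = c α

variable {I M}

/-- A set of pairs preserves and reflects the quantifier-free structure. -/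
structure Similar (S : Set (M × N)) : Prop where
  inO_iff : ∀ p ∈ S, InO I p.1 ↔ InO I p.2
  inP_iff : ∀ p ∈ S, ∀ α : I, InP α p.1 ↔ InP α p.2
  -- All equalities between terms are compared, so `S` need not be closed under projections; `c = d
  -- = none` makes `S` the graph of an injection.
  eq_iff : ∀ p ∈ S, ∀ p' ∈ S, ∀ c d : Option I,
    projOpt c p.1 = projOpt d p'.1 ↔ projOpt c p.2 = projOpt d p'.2

variable (I) in
theorem similar_empty : Similar (I := I) (∅ : Set (M × N)) :=
  ⟨by simp, by simp, by simp⟩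

namespace IsBase

variable (hM : IsBase I M)
include hM

theorem not_inO_of_inP {α : I} {x : M} (h : InP α x) : ¬ InO I x :=
  fun h' => hM.not_inP α x h' h

theorem not_inO_proj (α : I) (x : M) : ¬ InO I (proj α x) := by
  by_cases h : InO I x
  · exact hM.not_inO_of_inP (hM.inP_proj α x h)
  · rwa [hM.proj_eq α x h]

theorem projOpt_eq (c : Option I) {x : M} (h : ¬ InO I x) : projOpt c x = x := by
  cases c with
  | none => rfl
  | some α => exact hM.proj_eq α x h

/-- Every projection lands outside `O`, where all projections are the identity, so the outer one is
absorbed. -/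
theorem projOpt_projOpt (c d : Option I) (x : M) :
    projOpt c (projOpt d x) = projOpt (compIdx c d) x := by
  cases d with
  | none => rfl
  | some β => exact hM.projOpt_eq c (hM.not_inO_proj β x)

theorem inO_projOpt (c : Option I) (x : M) : InO I (projOpt c x) ↔ c = none ∧ InO I x := by
  cases c with
  | none => simp [projOpt]
  | some α => simp [projOpt, hM.not_inO_proj α x]

theorem inP_projOpt (β : I) (c : Option I) (x : M) :
    InP β (projOpt c x) ↔ (InO I x ∧ c = some β) ∨ (InP β x) := by
  cases c with
  | none => simp [projOpt]
  | some α =>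
    by_cases h : InO I x
    · have h1 := hM.inP_proj α x h
      simp only [projOpt, h, true_and, Option.some.injEq, hM.not_inP β x h, or_false]
      exact ⟨fun h2 => hM.eq_of_inP _ _ _ h1 h2, fun h2 => h2 ▸ h1⟩
    · simp [projOpt, h, hM.proj_eq α x h]

theorem projOpt_inj {x : M} (h : InO I x) (c d : Option I) :
    projOpt c x = projOpt d x ↔ c = d := by
  refine ⟨fun hcd => ?_, fun hcd => hcd ▸ rfl⟩
  cases c with
  | none =>
    cases d with
    | none => rfl
    | some β => exact absurd ((congrArg (InO I) hcd).mp h) (hM.not_inO_proj β x)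
  | some α =>
    cases d with
    | none => exact absurd ((congrArg (InO I) hcd.symm).mp h) (hM.not_inO_proj α x)
    | some β =>
      have h1 := hM.inP_proj α x h
      have h2 := hM.inP_proj β x h
      rw [show proj α x = proj β x from hcd] at h1
      exact congrArg some (hM.eq_of_inP _ _ _ h1 h2)

end IsBase

namespace Similar

variable {S : Set (M × N)}

theorem mono {S' : Set (M × N)} (hS : Similar (I := I) S) (h : S' ⊆ S) :
    Similar (I := I) S' :=
  ⟨fun p hp => hS.inO_iff p (h hp), fun p hp => hS.inP_iff p (h hp),
    fun p hp p' hp' => hS.eq_iff p (h hp) p' (h hp')⟩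

theorem symm (hS : Similar (I := I) S) : Similar (I := I) (Prod.swap ⁻¹' S) :=
  ⟨fun _ hp => (hS.inO_iff _ hp).symm, fun _ hp α => (hS.inP_iff _ hp α).symm,
    fun _ hp _ hp' c d => (hS.eq_iff _ hp _ hp' c d).symm⟩

theorem insert (hS : Similar (I := I) S) {a : M} {b : N} (hO : InO I a ↔ InO I b)
    (hP : ∀ α : I, InP α a ↔ InP α b)
    (hself : ∀ c d : Option I, projOpt c a = projOpt d a ↔ projOpt c b = projOpt d b)
    (hcross : ∀ p ∈ S, ∀ c d : Option I,
      projOpt c a = projOpt d p.1 ↔ projOpt c b = projOpt d p.2) :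
    Similar (I := I) (insert (a, b) S) := by
  refine ⟨?_, ?_, ?_⟩
  · rintro p (rfl | hp)
    exacts [hO, hS.inO_iff p hp]
  · rintro p (rfl | hp)
    exacts [hP, hS.inP_iff p hp]
  · rintro p (rfl | hp) p' (rfl | hp') c d
    · exact hself c d
    · exact hcross p' hp' c d
    · rw [eq_comm, hcross p hp d c, eq_comm]
    · exact hS.eq_iff p hp p' hp' c d

theorem inO_projOpt_iff (hS : Similar (I := I) S) (hM : IsBase I M) (hN : IsBase I N)
    {p : M × N} (hp : p ∈ S) (c : Option I) :
    InO I (projOpt c p.1) ↔ InO I (projOpt c p.2) := by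
  rw [hM.inO_projOpt, hN.inO_projOpt, hS.inO_iff p hp]

theorem inP_projOpt_iff (hS : Similar (I := I) S) (hM : IsBase I M) (hN : IsBase I N)
    {p : M × N} (hp : p ∈ S) (c : Option I) (α : I) :
    InP α (projOpt c p.1) ↔ InP α (projOpt c p.2) := by
  rw [hM.inP_projOpt, hN.inP_projOpt, hS.inO_iff p hp, hS.inP_iff p hp]

omit [(daggerLang I).Structure M] in
theorem finite_projOpt [Finite I] (hfin : S.Finite) :
    {y : N | ∃ p ∈ S, ∃ c : Option I, y = projOpt c p.2}.Finite := by
  refine ((hfin.prod (Set.finite_univ (α := Option I))).image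
    fun q => projOpt q.2 q.1.2).subset ?_
  rintro _ ⟨p, hp, c, rfl⟩
  exact ⟨(p, c), ⟨hp, trivial⟩, rfl⟩

/-- A point outside `O` has a counterpart over any finite similarity. -/
theorem exists_of_not_inO [Finite I] (hS : Similar (I := I) S) (hM : IsBase I M)
    (hN : IsRich I N) (hfin : S.Finite) {a : M} (ha : ¬ InO I a) :
    ∃ b : N, ¬ InO I b ∧ (∀ α : I, InP α a ↔ InP α b) ∧
      ∀ p ∈ S, ∀ d : Option I, a = projOpt d p.1 ↔ b = projOpt d p.2 := by
  by_cases h : ∃ p ∈ S, ∃ c : Option I, a = projOpt c p.1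
  · obtain ⟨p, hp, c, rfl⟩ := h
    exact ⟨projOpt c p.2, (hS.inO_projOpt_iff hM hN.toIsBase hp c).not.mp ha,
      hS.inP_projOpt_iff hM hN.toIsBase hp c, fun p' hp' d => hS.eq_iff p hp p' hp' c d⟩
  · push Not at h
    have key : ∀ b : N, b ∉ {y : N | ∃ p ∈ S, ∃ c : Option I, y = projOpt c p.2} →
        ∀ p ∈ S, ∀ d : Option I, a = projOpt d p.1 ↔ b = projOpt d p.2 := fun b hb p hp d =>
      ⟨fun h' => absurd h' (h p hp d), fun h' => absurd ⟨p, hp, d, h'⟩ hb⟩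
    by_cases hP : ∃ α : I, InP α a
    · obtain ⟨α, hα⟩ := hP
      obtain ⟨b, hb, hbα⟩ := hN.exists_inP α _ (finite_projOpt (I := I) hfin)
      refine ⟨b, hN.not_inO_of_inP hbα, fun β => ⟨fun hβ => ?_, fun hβ => ?_⟩, key b hb⟩
      · rwa [← hM.eq_of_inP _ _ _ hα hβ]
      · rwa [← hN.eq_of_inP _ _ _ hbα hβ]
    · push Not at hP
      obtain ⟨b, hb, hbO, hbP⟩ := hN.exists_rest _ (finite_projOpt (I := I) hfin)
      exact ⟨b, hbO, fun β => ⟨fun hβ => absurd hβ (hP β), fun hβ => absurd hβ (hbP β)⟩,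
        key b hb⟩

/-- The forth step: a finite similarity into a rich structure extends to any given point. -/
theorem exists_insert [Finite I] (hS : Similar (I := I) S) (hM : IsBase I M)
    (hN : IsRich I N) (hfin : S.Finite) (a : M) :
    ∃ b : N, Similar (I := I) (Insert.insert (a, b) S) := by
  by_cases h : ∃ p ∈ S, ∃ c : Option I, a = projOpt c p.1
  · obtain ⟨p, hp, c, rfl⟩ := h
    refine ⟨projOpt c p.2, hS.insert (hS.inO_projOpt_iff hM hN.toIsBase hp c)
      (hS.inP_projOpt_iff hM hN.toIsBase hp c) (fun c' d' => ?_) (fun p' hp' c' d' => ?_)⟩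
    · simp only [hM.projOpt_projOpt, hN.projOpt_projOpt]
      exact hS.eq_iff p hp p hp _ _
    · simp only [hM.projOpt_projOpt, hN.projOpt_projOpt]
      exact hS.eq_iff p hp p' hp' _ _
  · by_cases ha : InO I a
    · push Not at h
      -- The images of the projections can be chosen independently: they lie in disjoint sorts, so
      -- no equality between two of them has to be preserved.
      choose e _ heP he using fun α : I =>
        hS.exists_of_not_inO hM hN hfin (hM.not_inO_proj α a)
      obtain ⟨b, hb, hbO, hbe⟩ := hN.exists_inO e
        (fun α => (heP α α).mp (hM.inP_proj α a ha)) _ (finite_projOpt (I := I) hfin)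
      refine ⟨b, hS.insert (iff_of_true ha hbO) (fun α => iff_of_false (hM.not_inP α a ha)
        (hN.not_inP α b hbO)) (fun c d => ?_) (fun p hp c d => ?_)⟩
      · rw [hM.projOpt_inj ha, hN.projOpt_inj hbO]
      · cases c with
        | none => exact iff_of_false (h p hp d) fun h' => hb ⟨p, hp, d, h'⟩
        | some α =>
          change proj α a = _ ↔ proj α b = _
          rw [hbe]
          exact he α p hp d
    · obtain ⟨b, hbO, hbP, hb⟩ := hS.exists_of_not_inO hM hN hfin ha
      refine ⟨b, hS.insert (iff_of_false ha hbO) hbP (fun c d => ?_) (fun p hp c d => ?_)⟩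
      · simp [hM.projOpt_eq _ ha, hN.projOpt_eq _ hbO]
      · rw [hM.projOpt_eq _ ha, hN.projOpt_eq _ hbO]
        exact hb p hp d

theorem exists_insert_right [Finite I] (hS : Similar (I := I) S) (hM : IsRich I M)
    (hN : IsBase I N) (hfin : S.Finite) (b : N) :
    ∃ a : M, Similar (I := I) (Insert.insert (a, b) S) := by
  obtain ⟨a, ha⟩ := hS.symm.exists_insert hN hM
    (hfin.preimage Prod.swap_injective.injOn) b
  refine ⟨a, ha.symm.mono ?_⟩
  rintro p (rfl | hp)
  · exact Or.inl rfl
  · exact Or.inr hp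

/-- A finite similarity extends to any finite set of points. -/
theorem exists_superset [Finite I] (hS : Similar (I := I) S) (hM : IsBase I M)
    (hN : IsRich I N) (hfin : S.Finite) {D : Set M} (hD : D.Finite) :
    ∃ S' : Set (M × N), S ⊆ S' ∧ Similar (I := I) S' ∧ ∀ a ∈ D, ∃ b, (a, b) ∈ S' := by
  suffices ∃ S' : Set (M × N), S'.Finite ∧ S ⊆ S' ∧ Similar (I := I) S' ∧
      ∀ a ∈ D, ∃ b, (a, b) ∈ S' from this.imp fun _ h => h.2
  induction D, hD using Set.Finite.induction_on with
  | empty => exact ⟨S, hfin, subset_rfl, hS, by simp⟩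
  | @insert a D _ _ ih =>
    obtain ⟨S', hf, hSS', hS', hD'⟩ := ih
    obtain ⟨b, hb⟩ := hS'.exists_insert hM hN hf a
    refine ⟨_, hf.insert _, hSS'.trans (Set.subset_insert _ _), hb, ?_⟩
    rintro x (rfl | hx)
    · exact ⟨b, Or.inl rfl⟩
    · exact (hD' x hx).imp fun _ h => Or.inr h

/-- Since compositions of projections collapse, a term is a variable or one projection of a
variable, uniformly in both structures. This reduces atomic formulas to the clauses of `Similar`. -/
theorem exists_term_realize (hM : IsBase I M) (hN : IsBase I N) {γ : Type*}
    (x : γ → M) (y : γ → N) (t : (daggerLang I).Term γ) :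
    ∃ (i : γ) (c : Option I), t.realize x = projOpt c (x i) ∧ t.realize y = projOpt c (y i) := by
  induction t with
  | var i => exact ⟨i, none, rfl, rfl⟩
  | @func l f ts ih =>
    cases f with
    | p α =>
      obtain ⟨i, c, h1, h2⟩ := ih 0
      refine ⟨i, compIdx (some α) c, ?_, ?_⟩
      · rw [← hM.projOpt_projOpt, ← h1]
        exact funMap_p α _
      · rw [← hN.projOpt_projOpt, ← h2]
        exact funMap_p α _

/-- Similar tuples of rich structures satisfy the same formulas. -/
theorem realize_iff [Finite I] (hM : IsRich I M) (hN : IsRich I N) {γ : Type*} {n : ℕ}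
    (φ : (daggerLang I).BoundedFormula γ n) {S : Set (M × N)} (hS : Similar (I := I) S)
    (hfin : S.Finite) {x : γ → M} {y : γ → N} {xs : Fin n → M} {ys : Fin n → N}
    (hxy : ∀ i, (x i, y i) ∈ S) (hxys : ∀ i, (xs i, ys i) ∈ S) :
    φ.Realize x xs ↔ φ.Realize y ys := by
  have hmem : ∀ {n : ℕ} {xs : Fin n → M} {ys : Fin n → N} {S : Set (M × N)},
      (∀ i, (x i, y i) ∈ S) → (∀ i, (xs i, ys i) ∈ S) →
      ∀ i, (Sum.elim x xs i, Sum.elim y ys i) ∈ S := by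
    rintro n xs ys S h h' (i | i)
    exacts [h i, h' i]
  induction φ generalizing S with
  | falsum => rfl
  | equal t₁ t₂ =>
    obtain ⟨i, c, h1, h2⟩ := exists_term_realize hM.toIsBase hN.toIsBase
      (Sum.elim x xs) (Sum.elim y ys) t₁
    obtain ⟨j, d, h3, h4⟩ := exists_term_realize hM.toIsBase hN.toIsBase
      (Sum.elim x xs) (Sum.elim y ys) t₂
    simp only [BoundedFormula.Realize, h1, h2, h3, h4]
    exact hS.eq_iff _ (hmem hxy hxys i) _ (hmem hxy hxys j) c d
  | @rel n l R ts =>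
    obtain _ | α := R
    · obtain ⟨i, c, h1, h2⟩ := exists_term_realize hM.toIsBase hN.toIsBase
        (Sum.elim x xs) (Sum.elim y ys) (ts 0)
      refine (relMap_O _).trans (Iff.trans ?_ (relMap_O _).symm)
      rw [h1, h2]
      exact hS.inO_projOpt_iff hM.toIsBase hN.toIsBase (hmem hxy hxys i) c
    · obtain ⟨i, c, h1, h2⟩ := exists_term_realize hM.toIsBase hN.toIsBase
        (Sum.elim x xs) (Sum.elim y ys) (ts 0)
      refine (relMap_P α _).trans (Iff.trans ?_ (relMap_P α _).symm)
      rw [h1, h2]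
      exact hS.inP_projOpt_iff hM.toIsBase hN.toIsBase (hmem hxy hxys i) c α
  | imp _ _ ih₁ ih₂ =>
    exact imp_congr (ih₁ hS hfin hxy hxys) (ih₂ hS hfin hxy hxys)
  | @all n φ ih =>
    have hsnoc : ∀ (a : M) (b : N), ∀ i, ((Fin.snoc xs a : Fin (n + 1) → M) i,
        (Fin.snoc ys b : Fin (n + 1) → N) i) ∈ Insert.insert (a, b) S := by
      intro a b i
      refine Fin.lastCases ?_ (fun j => ?_) i
      · simp
      · simpa using Or.inr (hxys j)
    simp only [BoundedFormula.realize_all]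
    refine ⟨fun h b => ?_, fun h a => ?_⟩
    · obtain ⟨a, ha⟩ := hS.exists_insert_right hM hN.toIsBase hfin b
      exact (ih ha (hfin.insert _) (fun i => Or.inr (hxy i)) (hsnoc a b)).mp (h a)
    · obtain ⟨b, hb⟩ := hS.exists_insert hM.toIsBase hN hfin a
      exact (ih hb (hfin.insert _) (fun i => Or.inr (hxy i)) (hsnoc a b)).mpr (h b)

end Similar

/-- Any two rich structures over a finite index set are elementarily equivalent. -/
theorem IsRich.elementarilyEquivalent [Finite I] (hM : IsRich I M) (hN : IsRich I N)
    (ψ : (daggerLang I).Sentence) : M ⊨ ψ ↔ N ⊨ ψ :=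
  Similar.realize_iff hM hN ψ (similar_empty I) Set.finite_empty (fun i => i.elim)
    (fun i => i.elim0)

end Semantics

/-! ### First-order expressibility of richness. -/

section Axioms

variable {I : Type u} {M : Type v} [(daggerLang I).Structure M]
  {N : Type w} [(daggerLang I).Structure N]

variable (I) in
/-- The formula `O(x)`. -/
def formO {γ : Type*} (x : γ) : (daggerLang I).Formula γ :=
  Relations.formula₁ (L := daggerLang I) DaggerRel.O (Term.var x)

/-- The formula `P_α(x)`. -/
def formP {γ : Type*} (α : I) (x : γ) : (daggerLang I).Formula γ :=
  Relations.formula₁ (L := daggerLang I) (DaggerRel.P α) (Term.var x)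

/-- The formula `p_α(x) = y`. -/
def formProj {γ : Type*} (α : I) (x y : γ) : (daggerLang I).Formula γ :=
  Term.equal (Functions.apply₁ (L := daggerLang I) (DaggerFun.p α) (Term.var x)) (Term.var y)

/-- The formula `x ≠ y`. -/
def formNe {γ : Type*} (x y : γ) : (daggerLang I).Formula γ :=
  ∼(Term.equal (Term.var x) (Term.var y))

@[simp]
theorem realize_formO {γ : Type*} (x : γ) (f : γ → M) :
    (formO I x).Realize f ↔ InO I (f x) :=
  Formula.realize_rel₁ (L := daggerLang I)

@[simp]
theorem realize_formP {γ : Type*} (α : I) (x : γ) (f : γ → M) :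
    (formP α x).Realize f ↔ InP α (f x) :=
  Formula.realize_rel₁ (L := daggerLang I)

theorem realize_apply_p {γ : Type*} (α : I) (t : (daggerLang I).Term γ) (f : γ → M) :
    (Functions.apply₁ (L := daggerLang I) (DaggerFun.p α) t).realize f = proj α (t.realize f) :=
  Term.realize_functions_apply₁ (L := daggerLang I)

@[simp]
theorem realize_formProj {γ : Type*} (α : I) (x y : γ) (f : γ → M) :
    (formProj α x y).Realize f ↔ proj α (f x) = f y := by
  refine Formula.realize_equal.trans ?_
  rw [realize_apply_p]; rfl

@[simp]
theorem realize_formNe {γ : Type*} (x y : γ) (f : γ → M) :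
    (formNe (I := I) x y).Realize f ↔ f x ≠ f y :=
  Formula.realize_not.trans Formula.realize_equal.not

theorem realize_isO {n : ℕ} (t : (daggerLang I).Term (Empty ⊕ Fin n)) (x : Empty → M)
    (xs : Fin n → M) : (isO t).Realize x xs ↔ InO I (t.realize (Sum.elim x xs)) :=
  BoundedFormula.realize_rel₁ (L := daggerLang I)

theorem realize_isP {n : ℕ} (α : I) (t : (daggerLang I).Term (Empty ⊕ Fin n)) (x : Empty → M)
    (xs : Fin n → M) : (isP α t).Realize x xs ↔ InP α (t.realize (Sum.elim x xs)) :=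
  BoundedFormula.realize_rel₁ (L := daggerLang I)

theorem realize_app {n : ℕ} (α : I) (t : (daggerLang I).Term (Empty ⊕ Fin n))
    (x : Empty ⊕ Fin n → M) : (app α t).realize x = proj α (t.realize x) :=
  realize_apply_p α t x

theorem model_daggerBase_iff : M ⊨ daggerBase I ↔ IsBase I M := by
  have hx : ∀ (x : Empty → M) (a : M), Term.realize (L := daggerLang I)
      (Sum.elim x (Fin.snoc (default : Fin 0 → M) a : Fin 1 → M)) (&0) = a := fun _ _ => rfl
  simp only [daggerBase, Theory.model_iff]
  constructor
  · intro h
    refine ⟨fun α x => ?_, fun α β x => ?_, fun α x => ?_, fun α x => ?_⟩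
    · have := h _ (Or.inl (Or.inl (Or.inl ⟨α, rfl⟩)))
      simp only [Sentence.Realize, Formula.Realize, BoundedFormula.realize_all,
        BoundedFormula.realize_not, BoundedFormula.realize_inf, realize_isO, realize_isP,
        hx] at this
      exact not_and.mp (this x)
    · intro h1 h2
      by_contra hne
      have := h _ (Or.inl (Or.inl (Or.inr ⟨α, β, hne, rfl⟩)))
      simp only [Sentence.Realize, Formula.Realize, BoundedFormula.realize_all,
        BoundedFormula.realize_not, BoundedFormula.realize_inf, realize_isP, hx] at this
      exact this x ⟨h1, h2⟩
    · have := h _ (Or.inl (Or.inr ⟨α, rfl⟩))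
      simp only [Sentence.Realize, Formula.Realize, BoundedFormula.realize_all,
        BoundedFormula.realize_imp, realize_isO, realize_isP, realize_app, hx] at this
      exact this x
    · have := h _ (Or.inr ⟨α, rfl⟩)
      simp only [Sentence.Realize, Formula.Realize, BoundedFormula.realize_all,
        BoundedFormula.realize_imp, BoundedFormula.realize_not, realize_isO,
        BoundedFormula.realize_bdEqual, realize_app, hx] at this
      exact this x
  · rintro h _ (((⟨α, rfl⟩ | ⟨α, β, hne, rfl⟩) | ⟨α, rfl⟩) | ⟨α, rfl⟩)
    · simp only [Sentence.Realize, Formula.Realize, BoundedFormula.realize_all,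
        BoundedFormula.realize_not, BoundedFormula.realize_inf, realize_isO, realize_isP, hx]
      exact fun x hxx => h.not_inP α x hxx.1 hxx.2
    · simp only [Sentence.Realize, Formula.Realize, BoundedFormula.realize_all,
        BoundedFormula.realize_not, BoundedFormula.realize_inf, realize_isP, hx]
      exact fun x hxx => hne (h.eq_of_inP α β x hxx.1 hxx.2)
    · simp only [Sentence.Realize, Formula.Realize, BoundedFormula.realize_all,
        BoundedFormula.realize_imp, realize_isO, realize_isP, realize_app, hx]
      exact h.inP_proj α
    · simp only [Sentence.Realize, Formula.Realize, BoundedFormula.realize_all,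
        BoundedFormula.realize_imp, BoundedFormula.realize_not, realize_isO,
        BoundedFormula.realize_bdEqual, realize_app, hx]
      exact h.proj_eq α

/-- Formulas valid in a structure are valid in each structure satisfying the same sentences. -/
theorem realize_of_sentences {L : FirstOrder.Language.{u, u}} {M : Type v} [L.Structure M]
    {N : Type w} [L.Structure N] (h : ∀ ψ : L.Sentence, M ⊨ ψ → N ⊨ ψ)
    {γ : Type*} [Finite γ] (θ : L.Formula γ) (hM : ∀ x : γ → M, θ.Realize x)
    (y : γ → N) : θ.Realize y := by
  have key := h ((θ.relabel (Sum.inr : γ → Empty ⊕ γ)).iAlls γ)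
  simp only [Sentence.Realize, Formula.realize_iAlls, Formula.realize_relabel] at key
  exact key (fun x => hM x) y

theorem _root_.Set.Finite.exists_eq_range_fin {X : Type*} {F : Set X} (hF : F.Finite) :
    ∃ (m : ℕ) (e : Fin m → X), Set.range e = F := by
  obtain ⟨m, e, -, he⟩ := hF.fin_param
  exact ⟨m, e, he⟩

/-- Richness over a finite index set is a first-order property. -/
theorem IsRich.of_sentences [Finite I] (hM : IsRich I M)
    (h : ∀ ψ : (daggerLang I).Sentence, M ⊨ ψ → N ⊨ ψ) : IsRich I N where
  toIsBase := model_daggerBase_iff.mp <| (Theory.model_iff _).mpr fun ψ hψ =>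
    h ψ ((Theory.model_iff _).mp (model_daggerBase_iff.mpr hM.toIsBase) ψ hψ)
  exists_inP α F hF := by
    obtain ⟨m, e, rfl⟩ := hF.exists_eq_range_fin
    have := realize_of_sentences h (γ := Fin m) (Formula.iExs Unit
      (formP α (Sum.inr ()) ⊓ Formula.iInf fun i : Fin m => formNe (Sum.inl i) (Sum.inr ())))
      (fun x => by
        obtain ⟨y, hy, hyP⟩ := hM.exists_inP α _ (Set.finite_range x)
        simp only [Formula.realize_iExs, Formula.realize_inf, realize_formP,
          Formula.realize_iInf, realize_formNe]
        exact ⟨fun _ => y, hyP, fun i hi => hy ⟨i, hi⟩⟩) e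
    simp only [Formula.realize_iExs, Formula.realize_inf, realize_formP,
      Formula.realize_iInf, realize_formNe] at this
    obtain ⟨y, hyP, hy⟩ := this
    exact ⟨y (), fun ⟨i, hi⟩ => hy i hi, hyP⟩
  exists_rest F hF := by
    obtain ⟨m, e, rfl⟩ := hF.exists_eq_range_fin
    have := realize_of_sentences h (γ := Fin m) (Formula.iExs Unit
      ((∼(formO I (Sum.inr ())) ⊓ Formula.iInf fun α : I => ∼(formP α (Sum.inr ()))) ⊓
        Formula.iInf fun i : Fin m => formNe (Sum.inl i) (Sum.inr ())))
      (fun x => by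
        obtain ⟨y, hy, hyO, hyP⟩ := hM.exists_rest _ (Set.finite_range x)
        simp only [Formula.realize_iExs, Formula.realize_inf, realize_formP, realize_formO,
          Formula.realize_iInf, realize_formNe, Formula.realize_not]
        exact ⟨fun _ => y, ⟨hyO, hyP⟩, fun i hi => hy ⟨i, hi⟩⟩) e
    simp only [Formula.realize_iExs, Formula.realize_inf, realize_formP, realize_formO,
      Formula.realize_iInf, realize_formNe, Formula.realize_not] at this
    obtain ⟨y, ⟨hyO, hyP⟩, hy⟩ := this
    exact ⟨y (), fun ⟨i, hi⟩ => hy i hi, hyO, hyP⟩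
  exists_inO c hc F hF := by
    obtain ⟨m, e, rfl⟩ := hF.exists_eq_range_fin
    -- Variables in `I` stand for the prescribed projections, those in `Fin m` for the points to
    -- avoid; the conjunctions over `I` exist because `I` is finite.
    have := realize_of_sentences h (γ := I ⊕ Fin m)
      ((Formula.iInf fun α : I => formP α (Sum.inl α)) ⟹ Formula.iExs Unit
      ((formO I (Sum.inr ()) ⊓
        Formula.iInf fun α : I => formProj α (Sum.inr ()) (Sum.inl (Sum.inl α))) ⊓
        Formula.iInf fun i : Fin m => formNe (Sum.inl (Sum.inr i)) (Sum.inr ())))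
      (fun x => by
        simp only [Formula.realize_iExs, Formula.realize_inf, realize_formP, realize_formO,
          Formula.realize_iInf, realize_formNe, Formula.realize_imp, realize_formProj]
        intro hx
        obtain ⟨y, hy, hyO, hyp⟩ := hM.exists_inO (fun α => x (Sum.inl α)) hx _
          (Set.finite_range fun i => x (Sum.inr i))
        exact ⟨fun _ => y, ⟨hyO, hyp⟩, fun i hi => hy ⟨i, hi⟩⟩) (Sum.elim c e)
    simp only [Formula.realize_iExs, Formula.realize_inf, realize_formP, realize_formO,
      Formula.realize_iInf, realize_formNe, Formula.realize_imp, realize_formProj] at this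
    obtain ⟨y, ⟨hyO, hyp⟩, hy⟩ := this hc
    exact ⟨y (), fun ⟨i, hi⟩ => hy i hi, hyO, hyp⟩

end Axioms

/-! ### Countable rich structures as Fraïssé limits. -/

section Fraisse

variable {I : Type u} {M : Type v} [(daggerLang I).Structure M]
  {N : Type w} [(daggerLang I).Structure N]

theorem InO_embedding (g : M ↪[daggerLang I] N) (x : M) : InO I (g x) ↔ InO I x := by
  have := g.map_rel (n := 1) DaggerRel.O ![x]
  exact (relMap_O _).symm.trans this

theorem InP_embedding (g : M ↪[daggerLang I] N) (α : I) (x : M) : InP α (g x) ↔ InP α x := by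
  have := g.map_rel (n := 1) (DaggerRel.P α) ![x]
  exact (relMap_P α _).symm.trans this

theorem proj_embedding (g : M ↪[daggerLang I] N) (α : I) (x : M) :
    proj α (g x) = g (proj α x) := by
  have := g.map_fun (n := 1) (DaggerFun.p α) ![x]
  exact (funMap_p α _).symm.trans this.symm

theorem projOpt_embedding (g : M ↪[daggerLang I] N) (c : Option I) (x : M) :
    projOpt c (g x) = g (projOpt c x) := by
  cases c with
  | none => rfl
  | some α => exact proj_embedding g α x

theorem IsBase.of_embedding (hN : IsBase I N) (g : M ↪[daggerLang I] N) : IsBase I M where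
  not_inP α x := by
    rw [← InO_embedding g, ← InP_embedding g]
    exact hN.not_inP α _
  eq_of_inP α β x := by
    rw [← InP_embedding g, ← InP_embedding g]
    exact hN.eq_of_inP α β _
  inP_proj α x := by
    rw [← InO_embedding g, ← InP_embedding g, ← proj_embedding]
    exact hN.inP_proj α _
  proj_eq α x := by
    rw [← InO_embedding g, ← g.injective.eq_iff, ← proj_embedding]
    exact hN.proj_eq α _

/-- A finite similarity from a finite model of `T'` to a rich structure extends to an embedding. -/
theorem Similar.exists_embedding [Finite I] [Finite M] {S : Set (M × N)}
    (hS : Similar (I := I) S) (hM : IsBase I M) (hN : IsRich I N) :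
    ∃ g : M ↪[daggerLang I] N, ∀ p ∈ S, g p.1 = p.2 := by
  have hfin : S.Finite := by
    refine Set.Finite.of_finite_image (Set.toFinite (Prod.fst '' S)) ?_
    intro p hp p' hp' h
    exact Prod.ext h ((hS.eq_iff p hp p' hp' none none).mp h)
  obtain ⟨S', hSS', hS', hdom⟩ := hS.exists_superset hM hN hfin (Set.finite_univ (α := M))
  choose g hg using fun a => hdom a trivial
  have huniq : ∀ p ∈ S', g p.1 = p.2 := fun p hp =>
    (hS'.eq_iff _ (hg p.1) p hp none none).mp rfl
  refine ⟨⟨⟨g, fun a b h => (hS'.eq_iff _ (hg a) _ (hg b) none none).mpr h⟩, ?_, ?_⟩,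
    fun p hp => huniq p (hSS' hp)⟩
  · intro n f x
    obtain ⟨α⟩ := f
    change g (Structure.funMap (L := daggerLang I) (n := 1) (DaggerFun.p α) x) =
      Structure.funMap (L := daggerLang I) (n := 1) (DaggerFun.p α) (g ∘ x)
    rw [funMap_p, funMap_p]
    exact (hS'.eq_iff _ (hg (proj α (x 0))) _ (hg (x 0)) none (some α)).mp rfl
  · intro n R x
    obtain _ | α := R
    · exact (relMap_O _).trans ((hS'.inO_iff _ (hg (x 0))).symm.trans (relMap_O _).symm)
    · exact (relMap_P α _).trans ((hS'.inP_iff _ (hg (x 0)) α).symm.trans (relMap_P α _).symm)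

/-- In models of `T'` over a finite index set, finitely generated substructures are finite. -/
theorem IsBase.finite_of_fg [Finite I] (hM : IsBase I M) {S : (daggerLang I).Substructure M}
    (hS : S.FG) : Finite S := by
  obtain ⟨s, rfl⟩ := hS
  let T : (daggerLang I).Substructure M :=
    { carrier := {y | ∃ c : Option I, ∃ x ∈ s, y = projOpt c x}
      fun_mem := by
        intro n f xs h
        obtain ⟨α⟩ := f
        obtain ⟨c, x, hx, hy⟩ := h 0
        refine ⟨compIdx (some α) c, x, hx, ?_⟩
        rw [← hM.projOpt_projOpt, ← hy]
        exact funMap_p α xs }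
  have hT : (T : Set M).Finite := by
    refine (((Set.finite_univ (α := Option I)).prod s.finite_toSet).image
      fun q => projOpt q.1 q.2).subset ?_
    rintro _ ⟨c, x, hx, rfl⟩
    exact ⟨(c, x), ⟨trivial, hx⟩, rfl⟩
  have hle : Substructure.closure (daggerLang I) (s : Set M) ≤ T :=
    Substructure.closure_le.mpr fun x hx => ⟨none, x, hx, rfl⟩
  exact (hT.subset hle).to_subtype

/-- A countable rich structure over a finite index set is the Fraïssé limit of the finite models
of `T'`. -/
theorem IsRich.isFraisseLimit [Finite I] {N : Type} [(daggerLang I).Structure N] [Countable N]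
    (hN : IsRich I N) : IsFraisseLimit (daggerClass I) N where
  ultrahomogeneous := by
    rw [isUltrahomogeneous_iff_IsExtensionPair Structure.cg_of_countable,
      isExtensionPair_iff_exists_embedding_closure_singleton_sup]
    intro S hS f m
    have hfg : (Substructure.closure (daggerLang I) {m} ⊔ S).FG :=
      (Substructure.fg_closure_singleton m).sup hS
    have := hN.finite_of_fg hfg
    let i := Substructure.inclusion (L := daggerLang I)
      (le_sup_right : S ≤ Substructure.closure (daggerLang I) {m} ⊔ S)
    -- The partial embedding `f`, viewed as a similarity from the finite structure generated by `S`
    -- and `m`; extending it to that structure is the one-point extension property.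
    have hsim : Similar (I := I) (Set.range fun x : S => (i x, f x)) := by
      refine ⟨?_, ?_, ?_⟩
      · rintro _ ⟨x, rfl⟩
        exact (InO_embedding i x).trans (InO_embedding f x).symm
      · rintro _ ⟨x, rfl⟩ α
        exact (InP_embedding i α x).trans (InP_embedding f α x).symm
      · rintro _ ⟨x, rfl⟩ _ ⟨y, rfl⟩ c d
        simp only [projOpt_embedding, f.injective.eq_iff, i.injective.eq_iff]
    obtain ⟨g, hg⟩ := hsim.exists_embedding
      (hN.toIsBase.of_embedding (Substructure.subtype _)) hN
    exact ⟨g, Embedding.ext fun x => (hg _ ⟨x, rfl⟩).symm⟩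
  age := by
    ext A
    constructor
    · rintro ⟨hA, ⟨g⟩⟩
      have hbase := hN.toIsBase.of_embedding g
      refine ⟨?_, model_daggerBase_iff.mpr hbase⟩
      have := hbase.finite_of_fg hA.out
      exact Finite.of_equiv _ (Substructure.topEquiv (L := daggerLang I)).toEquiv
    · rintro ⟨hfin, hA⟩
      obtain ⟨g, -⟩ := (similar_empty I (M := A) (N := N)).exists_embedding
        (model_daggerBase_iff.mp hA) hN
      exact ⟨Structure.FG.of_finite, ⟨g⟩⟩

end Fraisse

/-! ### A concrete rich structure. -/

section StdModel

variable {I : Type u}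

/-- The universe of a rich structure: points of `O` are labelled by all choices of projections. -/
inductive StdModel (I : Type u) : Type u
  -- The label `k` provides infinitely many points with the same projections.
  | o (f : I → ℕ) (k : ℕ)
  | pt (α : I) (k : ℕ)
  | rest (k : ℕ)

namespace StdModel

/-- The points of `O`. -/
def IsO : StdModel I → Prop
  | o _ _ => True
  | _ => False

/-- The points of `P α`. -/
def IsP (α : I) : StdModel I → Prop
  | pt β _ => β = α
  | _ => False

/-- The projection to `P α`. -/
def toP (α : I) : StdModel I → StdModel I
  | o f _ => pt α (f α)
  | x => x

instance : (daggerLang I).Structure (StdModel I) where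
  funMap := fun f x => match f, x with
    | DaggerFun.p α, x => toP α (x 0)
  RelMap := fun R x => match R, x with
    | DaggerRel.O, x => IsO (x 0)
    | DaggerRel.P α, x => IsP α (x 0)

/-- Finiteness matters: for infinite `I` there are uncountably many labels `I → ℕ`. -/
instance [Finite I] : Countable (StdModel I) := by
  refine Function.Injective.countable
    (f := fun x : StdModel I => (match x with
      | o f k => Sum.inl (f, k)
      | pt α k => Sum.inr (Sum.inl (α, k))
      | rest k => Sum.inr (Sum.inr k) : ((I → ℕ) × ℕ) ⊕ ((I × ℕ) ⊕ ℕ))) ?_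
  rintro (_ | _ | _) (_ | _ | _) h <;> simp_all

-- Used twice: finite `I` gives the countable structure that is the Fraïssé limit, and `I = κ` gives
-- the model carrying the long pattern.
variable (I) in
theorem isRich : IsRich I (StdModel I) := by
  have avoid : ∀ (g : ℕ → StdModel I), Function.Injective g → ∀ F : Set (StdModel I), F.Finite →
      ∃ k, g k ∉ F := fun g hg F hF => by
    obtain ⟨_, ⟨k, rfl⟩, hk⟩ := (Set.infinite_range_of_injective hg).exists_notMem_finite hF
    exact ⟨k, hk⟩
  refine ⟨⟨?_, ?_, ?_, ?_⟩, ?_, ?_, ?_⟩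
  · rintro α (_ | _ | _) h h'
    exacts [h', h, h]
  · rintro α β (_ | _ | _) h h'
    exacts [h.elim, h.symm.trans h', h.elim]
  · rintro α (_ | _ | _) h
    exacts [rfl, h.elim, h.elim]
  · rintro α (_ | _ | _) h
    exacts [absurd trivial h, rfl, rfl]
  · intro α F hF
    obtain ⟨k, hk⟩ := avoid (pt α) (fun _ _ h => by simpa using h) F hF
    exact ⟨_, hk, rfl⟩
  · intro F hF
    obtain ⟨k, hk⟩ := avoid rest (fun _ _ h => by simpa using h) F hF
    exact ⟨_, hk, id, fun _ => id⟩
  · intro c hc F hF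
    have hc' : ∀ α, ∃ k, c α = pt α k := fun α => by
      have := hc α
      rcases h : c α with _ | ⟨β, k⟩ | _
      · rw [h] at this; exact this.elim
      · rw [h] at this; exact ⟨k, congrArg (pt · k) this⟩
      · rw [h] at this; exact this.elim
    choose f hf using hc'
    obtain ⟨k, hk⟩ := avoid (o f) (fun _ _ h => by simpa using h) F hF
    exact ⟨_, hk, trivial, fun α => (hf α).symm⟩

instance : Infinite (StdModel I) :=
  Infinite.of_injective rest fun _ _ h => by simpa using h

end StdModel

end StdModel

/-! ### Models of the theory and finite sublanguages. -/

section Theory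

variable {I : Type u} {M : Type v} [(daggerLang I).Structure M]

/-- A rich structure has rich reducts. -/
theorem IsRich.reduct (hM : IsRich I M) (w : Finset I) :
    let := (incl w).reduct M
    IsRich w M := by
  classical
  let := (incl w).reduct M
  refine ⟨⟨fun α => hM.not_inP α, fun α β x h h' => Subtype.ext (hM.eq_of_inP α β x h h'),
    fun α => hM.inP_proj α, fun α => hM.proj_eq α⟩, fun α => hM.exists_inP α, fun F hF => ?_,
    fun c hc F hF => ?_⟩
  · obtain ⟨y, hy, hO, hP⟩ := hM.exists_rest F hF
    exact ⟨y, hy, hO, fun α => hP α⟩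
  · choose e _ he using fun α : I => hM.exists_inP α ∅ Set.finite_empty
    obtain ⟨y, hy, hO, hp⟩ := hM.exists_inO (fun α => if h : α ∈ w then c ⟨α, h⟩ else e α)
      (fun α => by
        by_cases h : α ∈ w
        · rw [dif_pos h]; exact hc ⟨α, h⟩
        · rw [dif_neg h]; exact he α) F hF
    exact ⟨y, hy, hO, fun α => (hp α).trans (dif_pos α.2)⟩

/-- The carrier is moved to `ℕ` because `daggerFraisse` only ranges over structures in `Type`. -/
theorem exists_countable_isRich (J : Type u) [Finite J] :
    ∃ (N : Type) (_ : (daggerLang J).Structure N), Countable N ∧ IsRich J N := by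
  obtain ⟨e⟩ := nonempty_equiv_of_countable (α := StdModel J) (β := ℕ)
  let : (daggerLang J).Structure ℕ := e.inducedStructure
  refine ⟨ℕ, inferInstance, inferInstance, (StdModel.isRich J).of_sentences fun ψ hψ => ?_⟩
  exact (StrongHomClass.realize_sentence (Equiv.inducedStructureEquiv e) ψ).mp hψ

/-- For a finite index set, the theory of the Fraïssé limit is the common theory of the rich
structures. -/
theorem model_daggerFraisse_iff {J : Type u} [Finite J] {M : Type v} [(daggerLang J).Structure M] :
    M ⊨ daggerFraisse J ↔ IsRich J M := by
  obtain ⟨N, _, hc, hN⟩ := exists_countable_isRich J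
  constructor
  · intro h
    refine hN.of_sentences fun ψ hψ => ?_
    exact (Theory.model_iff _).mp h ψ ⟨N, inferInstance, hc, hN.isFraisseLimit, hψ⟩
  · intro h
    refine (Theory.model_iff _).mpr ?_
    rintro ψ ⟨N', _, hc', hN', hψ⟩
    obtain ⟨g⟩ := IsFraisseLimit.nonempty_equiv hN' hN.isFraisseLimit
    exact (hN.elementarilyEquivalent h ψ).mp ((StrongHomClass.realize_sentence g ψ).mp hψ)

/-- Richness is only asserted for finite reducts: over an infinite `I`, a model may omit some
choices of projections. -/
theorem model_daggerTheory_iff :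
    M ⊨ daggerTheory I ↔ ∀ w : Finset I, letI := (incl w).reduct M; IsRich w M := by
  have key : ∀ w : Finset I, M ⊨ (incl w).onTheory (daggerFraisse w) ↔
      (letI := (incl w).reduct M; IsRich w M) := fun w => by
    let := (incl w).reduct M
    exact (LHom.onTheory_model _ _).trans model_daggerFraisse_iff
  simp only [← key, daggerTheory, Theory.model_iff, Set.mem_iUnion]
  exact ⟨fun h w ψ hψ => h ψ ⟨w, hψ⟩, fun h ψ ⟨w, hψ⟩ => h w ψ hψ⟩

theorem IsRich.model_daggerTheory (hM : IsRich I M) : M ⊨ daggerTheory I :=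
  model_daggerTheory_iff.mpr hM.reduct

/-- Every term only uses finitely many indices. -/
theorem exists_onTerm_eq {γ : Type*} (t : (daggerLang I).Term γ) :
    ∃ w₀ : Finset I, ∀ w, w₀ ⊆ w → ∃ s : (daggerLang w).Term γ, (incl w).onTerm s = t := by
  classical
  induction t with
  | var i => exact ⟨∅, fun w _ => ⟨Term.var i, rfl⟩⟩
  | func f ts ih =>
    obtain ⟨α⟩ := f
    obtain ⟨w₀, h⟩ := ih 0
    refine ⟨Insert.insert α w₀, fun w hw => ?_⟩
    obtain ⟨s, hs⟩ := h w ((Finset.subset_insert _ _).trans hw)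
    refine ⟨Term.func (L := daggerLang w) (l := 1)
      (DaggerFun.p ⟨α, hw (Finset.mem_insert_self _ _)⟩) fun _ => s, ?_⟩
    refine congrArg (Term.func (L := daggerLang I) (l := 1) (DaggerFun.p α)) (funext fun j => ?_)
    rw [Subsingleton.elim j 0]
    exact hs

/-- Every formula only uses finitely many indices. -/
theorem exists_onBoundedFormula_eq {γ : Type*} {n : ℕ} (φ : (daggerLang I).BoundedFormula γ n) :
    ∃ w₀ : Finset I, ∀ w, w₀ ⊆ w →
      ∃ ψ : (daggerLang w).BoundedFormula γ n, (incl w).onBoundedFormula ψ = φ := by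
  classical
  induction φ with
  | falsum => exact ⟨∅, fun w _ => ⟨BoundedFormula.falsum, rfl⟩⟩
  | equal t₁ t₂ =>
    obtain ⟨w₁, h₁⟩ := exists_onTerm_eq t₁
    obtain ⟨w₂, h₂⟩ := exists_onTerm_eq t₂
    -- Asking for a lift to every larger `w` is what allows the two index sets to be merged.
    refine ⟨w₁ ∪ w₂, fun w hw => ?_⟩
    obtain ⟨s₁, rfl⟩ := h₁ w (Finset.union_subset_left hw)
    obtain ⟨s₂, rfl⟩ := h₂ w (Finset.union_subset_right hw)
    exact ⟨BoundedFormula.equal s₁ s₂, rfl⟩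
  | @rel n l R ts =>
    obtain _ | α := R
    · obtain ⟨w₀, h⟩ := exists_onTerm_eq (ts 0)
      refine ⟨w₀, fun w hw => ?_⟩
      obtain ⟨s, hs⟩ := h w hw
      refine ⟨BoundedFormula.rel (L := daggerLang w) (l := 1) DaggerRel.O fun _ => s, ?_⟩
      refine congrArg (BoundedFormula.rel (L := daggerLang I) (l := 1) DaggerRel.O)
        (funext fun j => ?_)
      rw [Subsingleton.elim j 0]
      exact hs
    · obtain ⟨w₀, h⟩ := exists_onTerm_eq (ts 0)
      refine ⟨Insert.insert α w₀, fun w hw => ?_⟩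
      obtain ⟨s, hs⟩ := h w ((Finset.subset_insert _ _).trans hw)
      refine ⟨BoundedFormula.rel (L := daggerLang w) (l := 1)
        (DaggerRel.P ⟨α, hw (Finset.mem_insert_self _ _)⟩) fun _ => s, ?_⟩
      refine congrArg (BoundedFormula.rel (L := daggerLang I) (l := 1) (DaggerRel.P α))
        (funext fun j => ?_)
      rw [Subsingleton.elim j 0]
      exact hs
  | imp _ _ ih₁ ih₂ =>
    obtain ⟨w₁, h₁⟩ := ih₁
    obtain ⟨w₂, h₂⟩ := ih₂
    refine ⟨w₁ ∪ w₂, fun w hw => ?_⟩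
    obtain ⟨s₁, rfl⟩ := h₁ w (Finset.union_subset_left hw)
    obtain ⟨s₂, rfl⟩ := h₂ w (Finset.union_subset_right hw)
    exact ⟨s₁.imp s₂, rfl⟩
  | all _ ih =>
    obtain ⟨w₀, h⟩ := ih
    refine ⟨w₀, fun w hw => ?_⟩
    obtain ⟨s, rfl⟩ := h w hw
    exact ⟨s.all, rfl⟩

end Theory

/-! ### Bounds on the height of inp-patterns. -/

section InpPattern

/-- Over a countable set of parameters there are only countably many types of `n`-tuples. -/
theorem exists_countable_code {J : Type u} [Finite J] {M : Type v} [(daggerLang J).Structure M]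
    (n : ℕ) (A : Set M) (hA : A.Countable) :
    ∃ (C : Type (max u v)) (_ : Countable C) (code : (Fin n → M) → C), ∀ b b', code b = code b' →
      ∀ {m : ℕ} (a : Fin m → M), (∀ l, a l ∈ A) →
        Similar (I := J) (Set.range fun x => (Sum.elim b a x, Sum.elim b' a x)) := by
  classical
  let A' : Set M := {z | ∃ (c : Option J) (x : M), x ∈ A ∧ z = projOpt c x}
  have hA' : Countable A' := by
    refine (((Set.countable_univ (α := Option J)).prod hA).image
      fun q => projOpt q.1 q.2).mono ?_ |>.to_subtype
    rintro _ ⟨c, x, hx, rfl⟩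
    exact ⟨(c, x), ⟨trivial, hx⟩, rfl⟩
  -- `A'` consists of the points generated by `A`. The code of `b` is its quantifier-free diagram
  -- together with the name, if any, of each projection in `A'`.
  let f : M → Option A' := fun z => if h : z ∈ A' then some ⟨z, h⟩ else none
  have hf : ∀ x y, f x = f y → ∀ z ∈ A', x = z ↔ y = z := by
    intro x y hxy z hz
    by_cases hx : x ∈ A' <;> by_cases hy : y ∈ A' <;> simp_all [f]
    exact iff_of_false (fun h => hx (h ▸ hz)) (fun h => hy (h ▸ hz))
  refine ⟨((Fin n → Prop) × (Fin n → J → Prop) ×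
    (Fin n → Fin n → Option J → Option J → Prop)) × (Fin n → Option J → Option A'), inferInstance,
    fun b => (⟨fun i => InO J (b i), fun i α => InP α (b i),
      fun i j c d => projOpt c (b i) = projOpt d (b j)⟩, fun i c => f (projOpt c (b i))), ?_⟩
  intro b b' hbb' m a ha
  simp only [Prod.mk.injEq, funext_iff, eq_iff_iff] at hbb'
  obtain ⟨⟨hO, hP, hE⟩, hF⟩ := hbb'
  have hcross : ∀ i l c d, projOpt c (b i) = projOpt d (a l) ↔
      projOpt c (b' i) = projOpt d (a l) := fun i l c d =>
    hf _ _ (hF i c) _ ⟨d, a l, ha l, rfl⟩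
  refine ⟨?_, ?_, ?_⟩
  · rintro _ ⟨i | l, rfl⟩
    exacts [hO i, Iff.rfl]
  · rintro _ ⟨i | l, rfl⟩ α
    exacts [hP i α, Iff.rfl]
  · rintro _ ⟨i | l, rfl⟩ _ ⟨j | l', rfl⟩ c d
    · exact hE i j c d
    · exact hcross i l' c d
    · exact eq_comm.trans ((hcross j l d c).trans eq_comm)
    · exact Iff.rfl

/-- If all paths are realized in a rich structure over a finite index set, then some row of
a sequence of families is not inconsistent. -/
theorem exists_row_consistent {J : Type u} [Finite J] {M : Type v} [(daggerLang J).Structure M]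
    (hM : IsRich J M) {n : ℕ} (arity : ℕ → ℕ)
    (φ : ∀ i, (daggerLang J).Formula (Fin n ⊕ Fin (arity i))) (a : ∀ i, ℕ → Fin (arity i) → M)
    (k : ℕ → ℕ)
    (hpath : ∀ η : ℕ → ℕ, ∃ b : Fin n → M, ∀ i, (φ i).Realize (Sum.elim b (a i (η i)))) :
    ∃ (i : ℕ) (s : Finset ℕ), s.card = k i ∧
      ∃ b : Fin n → M, ∀ j ∈ s, (φ i).Realize (Sum.elim b (a i j)) := by
  by_contra! hrow
  obtain ⟨C, _, code, hcode⟩ := exists_countable_code (J := J) n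
    (Set.range fun q : Σ i, ℕ × Fin (arity i) => a q.1 q.2.1 q.2.2) (Set.countable_range _)
  have htype : ∀ b b', code b = code b' → ∀ i j,
      (φ i).Realize (Sum.elim b (a i j)) ↔ (φ i).Realize (Sum.elim b' (a i j)) := fun b b' h i j =>
    (hcode b b' h (a i j) fun l => ⟨⟨i, j, l⟩, rfl⟩).realize_iff hM hM (φ i)
      (Set.finite_range _) (fun x => ⟨x, rfl⟩) fun x => x.elim0
  have hne : Nonempty (Set.range code) :=
    let ⟨b, _⟩ := hpath 0
    ⟨⟨_, b, rfl⟩⟩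
  obtain ⟨e, he⟩ := exists_surjective_nat (Set.range code)
  -- Diagonal step: if the `m`-th code were compatible with every member of row `m`, one tuple with
  -- that code would satisfy all of them, against the inconsistency of the row.
  have hfresh : ∀ m : ℕ, ∃ j : ℕ, ∀ b, code b = e m → ¬ (φ m).Realize (Sum.elim b (a m j)) := by
    intro m
    by_contra! hall
    obtain ⟨b, hb⟩ := (e m).2
    obtain ⟨j, hj, hj'⟩ := hrow m (Finset.range (k m)) (Finset.card_range _) b
    obtain ⟨b', hb', hr⟩ := hall j
    exact hj' ((htype b' b (hb'.trans hb.symm) m j).mp hr)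
  choose η hη using hfresh
  obtain ⟨b, hb⟩ := hpath η
  obtain ⟨m, hm⟩ := he ⟨code b, b, rfl⟩
  exact hη m b (congrArg Subtype.val hm).symm (hb m)

/-- A rich structure over a finite index set has no inp-pattern with infinitely many rows. -/
theorem exists_row_consistent_of_finite_paths {J : Type u} [Finite J] {M : Type v}
    [(daggerLang J).Structure M] (hM : IsRich J M) {n : ℕ} (arity : ℕ → ℕ)
    (φ : ∀ i, (daggerLang J).Formula (Fin n ⊕ Fin (arity i))) (a : ∀ i, ℕ → Fin (arity i) → M)
    (k : ℕ → ℕ) (hpath : ∀ (η : ℕ → ℕ) (s : Finset ℕ),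
      ∃ b : Fin n → M, ∀ i ∈ s, (φ i).Realize (Sum.elim b (a i (η i)))) :
    ∃ (i : ℕ) (s : Finset ℕ), s.card = k i ∧
      ∃ b : Fin n → M, ∀ j ∈ s, (φ i).Realize (Sum.elim b (a i j)) := by
  have : Nonempty M := let ⟨y, _⟩ := hM.exists_rest ∅ Set.finite_empty; ⟨y⟩
  let U : Ultrafilter ℕ := Filter.hyperfilter ℕ
  let M' := (U : Filter ℕ).Product fun _ => M
  let ofSeq : (ℕ → M) → M' := fun x => (x : (U : Filter ℕ).Product fun _ => M)
  have hlos : ∀ {m : ℕ} (θ : (daggerLang J).Formula (Fin n ⊕ Fin m)) (b : Fin n → ℕ → M)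
      (y : Fin m → M), θ.Realize (Sum.elim (fun l => ofSeq (b l)) fun l => ofSeq fun _ => y l) ↔
        ∀ᶠ t in (U : Filter ℕ), θ.Realize (Sum.elim (fun l => b l t) y) := by
    intro m θ b y
    have := Ultraproduct.realize_formula_cast (u := U) (M := fun _ => M) θ
      (Sum.elim b fun l _ => y l)
    have h1 : (Sum.elim (fun l => ofSeq (b l)) fun l => ofSeq fun _ => y l) =
        fun x => ofSeq (Sum.elim b (fun l _ => y l) x) := by
      funext x
      cases x <;> rfl
    have h2 : ∀ t, Sum.elim (fun l => b l t) y = fun x => Sum.elim b (fun l _ => y l) x t := by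
      intro t
      funext x
      cases x <;> rfl
    rw [h1]
    simp only [h2]
    exact this
  have hM' : IsRich J M' := hM.of_sentences fun ψ hψ =>
    (Ultraproduct.sentence_realize ψ).mpr (Filter.Eventually.of_forall fun _ => hψ)
  obtain ⟨i, s, hs, b, hb⟩ := exists_row_consistent hM' arity φ
    (fun i j l => ofSeq fun _ => a i j l) k (fun η => by
      -- `β t` realizes rows `0` to `t` of the path, so the class of `β` in the ultrapower realizes
      -- every row.
      choose β hβ using fun t : ℕ => hpath η (Finset.range (t + 1))
      refine ⟨fun l => ofSeq fun t => β t l, fun i => (hlos _ _ _).mpr ?_⟩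
      have : ∀ᶠ t in (U : Filter ℕ), i ≤ t := Nat.hyperfilter_le_atTop (Filter.eventually_ge_atTop i)
      exact this.mono fun t ht => hβ t i (Finset.mem_range.mpr (Nat.lt_succ_of_le ht)))
  choose r hr using fun l => Quotient.exists_rep (b l)
  obtain rfl : (fun l => ofSeq (r l)) = b := funext hr
  have hev : ∀ᶠ t in (U : Filter ℕ), ∀ j ∈ s,
      (φ i).Realize (Sum.elim (fun l => r l t) (a i j)) :=
    (Filter.eventually_all_finset s).mpr fun j hj => (hlos _ _ _).mp (hb j hj)
  obtain ⟨t, ht⟩ := hev.exists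
  exact ⟨i, s, hs, _, ht⟩

/-- In models of `T^†` with infinite index set `I`, the rows of an inp-pattern are at
most as many as the indices. -/
theorem isEmpty_inpPattern {I : Type u} [Infinite I] {M : Type u} [(daggerLang I).Structure M]
    (hM : M ⊨ daggerTheory I) {n : ℕ} {ι : Type u} (hι : #I < #ι) :
    IsEmpty (InpPattern (L := daggerLang I) M n ι) := by
  refine ⟨fun P => ?_⟩
  choose w hw using fun i => exists_onBoundedFormula_eq (P.φ i)
  -- Pigeonhole: the infinite set `I` has as many finite subsets as elements, hence fewer than there
  -- are rows.
  obtain ⟨w₀, hw₀⟩ := exists_infinite_fiber' w (by rwa [mk_finset_of_infinite])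
  let f : ℕ ↪ (w ⁻¹' {w₀}) := Infinite.natEmbedding _
  let g : ℕ ↪ ι := f.trans (Function.Embedding.subtype _)
  have hlift : ∀ t : ℕ, ∃ ψ : (daggerLang w₀).Formula (Fin n ⊕ Fin (P.arity (g t))),
      (incl w₀).onFormula ψ = P.φ (g t) := fun t => hw (g t) w₀ (f t).2.le
  choose ψ hψ using hlift
  let := (incl w₀).reduct M
  have hreal : ∀ t (x : _ → M), (ψ t).Realize x ↔ (P.φ (g t)).Realize x := fun t x => by
    rw [← hψ t, LHom.realize_onFormula]
  obtain ⟨t, s, hs, b, hb⟩ := exists_row_consistent_of_finite_paths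
    (model_daggerTheory_iff.mp hM w₀) (fun t => P.arity (g t)) ψ (fun t => P.a (g t))
    (fun t => P.k (g t)) (fun η s => by
      -- The value `0` on rows outside the chosen sequence is immaterial.
      obtain ⟨b, hb⟩ := P.path_consistent (Function.extend g η 0) (s.map g)
      refine ⟨b, fun t ht => (hreal t _).mpr ?_⟩
      have := hb (g t) (Finset.mem_map_of_mem g ht)
      rwa [g.injective.extend_apply] at this)
  exact P.row_inconsistent (g t) s hs ⟨b, fun j hj => (hreal t _).mp (hb j hj)⟩

/-- The pattern `p_α(x) = y` with rows indexed by (part of) `I`. -/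
theorem nonempty_inpPattern {I : Type u} {M : Type u} [(daggerLang I).Structure M]
    (hM : IsRich I M) {ι : Type u} (g : ι ↪ I) :
    Nonempty (InpPattern (L := daggerLang I) M 1 ι) := by
  have hinf : ∀ α : I, ∃ y : ℕ → M, Function.Injective y ∧ ∀ j, InP α (y j) := fun α => by
    have : {y : M | InP α y}.Infinite := fun h =>
      let ⟨y, hy, hyP⟩ := hM.exists_inP α _ h
      hy hyP
    exact ⟨fun j => this.natEmbedding _ j,
      Subtype.val_injective.comp (this.natEmbedding _).injective,
      fun j => (this.natEmbedding _ j).2⟩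
  choose y hinj hP using hinf
  refine ⟨⟨fun _ => 1, fun i => formProj (g i) (Sum.inl 0) (Sum.inr 0), fun i j _ => y (g i) j,
    fun _ => 2, fun η s => ?_, fun i s hs => ?_⟩⟩
  · obtain ⟨x, -, -, hx⟩ := hM.exists_inO (fun α => y α (Function.extend g η 0 α))
      (fun α => hP α _) ∅ Set.finite_empty
    refine ⟨fun _ => x, fun i _ => (realize_formProj _ _ _ _).mpr ?_⟩
    have := hx (g i)
    rwa [g.injective.extend_apply] at this
  · rintro ⟨b, hb⟩
    obtain ⟨j, j', hne, rfl⟩ := Finset.card_eq_two.mp hs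
    have h1 := (realize_formProj _ _ _ _).mp (hb j (by simp))
    have h2 := (realize_formProj _ _ _ _).mp (hb j' (by simp))
    exact hne (hinj (g i) (h1.symm.trans h2))

end InpPattern

end daggerLang

theorem mainTheorem8 (κ : Cardinal.{u}) (hreg : κ.IsRegular) (hunc : ℵ₀ < κ) :
    kappaInp (daggerTheory κ.ord.ToType) = ((Order.succ κ : Cardinal.{u}) : WithTop Cardinal.{u}) := by
  have hinf : Infinite κ.ord.ToType := infinite_iff.mpr (by rw [mk_ord_toType]; exact hunc.le)
  apply le_antisymm
  · refine iSup_le fun n => sInf_le ⟨Order.succ κ, ?_, rfl⟩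
    rintro ⟨M, ⟨P⟩⟩
    exact (daggerLang.isEmpty_inpPattern M.is_model (by
      rw [mk_ord_toType, mk_ord_toType]; exact Order.lt_succ κ)).false P
  · refine le_trans (le_sInf ?_) (le_iSup (kappaInpVar (daggerTheory κ.ord.ToType)) 1)
    rintro _ ⟨c, hc, rfl⟩
    -- Every height `c ≤ κ` must be excluded from the infimum, so the pattern is built for each such
    -- `c` along an injection into `κ`.
    refine WithTop.coe_le_coe.mpr (Order.succ_le_of_lt (lt_of_not_ge fun hle => hc ?_))
    have hrich := daggerLang.StdModel.isRich κ.ord.ToType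
    obtain ⟨g⟩ : Nonempty (c.ord.ToType ↪ κ.ord.ToType) := by
      rw [← Cardinal.le_def, mk_ord_toType, mk_ord_toType]; exact hle
    have := hrich.model_daggerTheory
    exact ⟨Theory.ModelType.of _ (daggerLang.StdModel κ.ord.ToType),
      daggerLang.nonempty_inpPattern hrich g⟩
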